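/- Let $(\Omega,\mathcal F,\mathbb P)$ be a probability space, let $L^0$ be the space of real random variables modulo a.s. equality, ordered by the a.s. pointwise order, and write $X^-=\max\{-X,0\}$. Let $\mathcal X$ be either $L^\infty$ equipped with the weak-star topology $\sigma(L^\infty,L^1)$, or a linear subspace of $L^0$ with a topology making it a Fréchet lattice (a completely metrizable, locally solid Riesz space) such that: $X_n\downarrow 0$ a.s. in $\mathcal X$ implies $X_n\to0$ in $\mathcal X$; there are dense continuous embeddings $L^\infty\hookrightarrow\mathcal X\hookrightarrow L^0$, where $L^\infty$ carries the sup-norm and $L^0$ the topology of convergence in probability; and $1_A\mathcal X\subset\mathcal X$ for every $A\in\mathcal F$. An acceptance set is a nonempty set $\mathcal A\subsetneq\mathcal X$ such that $X\in\mathcal A$, $Y\in\mathcal X$ and $Y\ge X$ imply $Y\in\mathcal A$; it is surplus invariant if $X\in\mathcal A$, $Y\in\mathcal X$ and $Y^-\le X^-$ imply $Y\in\mathcal A$. Put $\mathcal A^\infty=\mathcal A\cap L^\infty$. For a nonempty set $\mathcal C\subset L^\infty$ let $\sigma_{\mathcal C}(Z)=\inf_{X\in\mathcal C}\mathbb E[XZ]\in\mathbb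 R\cup\{-\infty\}$ for $Z\in L^1$, with barrier cone $B(\mathcal C)=\{Z\in L^1:\sigma_{\mathcal C}(Z)>-\infty\}$. For $A\in\mathcal F$ let $1_A\mathcal A=\{1_AX:X\in\mathcal A\}$, $\mathcal X(A)=1_A\mathcal X$ and $\mathcal X_+(A)=\{X\in\mathcal X(A):X\ge0\}$. Let $\mathrm{rec}(\mathcal A)=\bigcap_{\alpha>0}\alpha\mathcal A$. For subsets of $\mathcal X$, $\mathcal S=\mathcal U\oplus\mathcal V$ means that $\mathcal S=\{U+V:U\in\mathcal U,\,V\in\mathcal V\}$ and that this representation of each element of $\mathcal S$ is unique. Let $\mathcal A\subset\mathcal X$ be a closed, convex, surplus-invariant acceptance set. Then there exists $C\in\mathcal F$ such that (i) $Z=0$ a.s. on $C$ for every $Z\in B(\mathcal A^\infty)$; (ii) $Z^*>0$ a.s. on $C^c$ for some $Z^*\in B(\mathcal A^\infty)\cap L^\infty$. Moreover, $$\mathcal A=\mathcal X(C)\oplus 1_{C^c}\mathcal A\qquad\text{and}\qquad \mathrm{rec}(\mathcal A)=\mathcal X(C)\oplus\mathcal X_+(C^c).$$ -/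

import Mathlib

open MeasureTheory Filter Topology
open scoped ENNReal Pointwise

namespace SurplusInvariance

variable {Ω : Type*} [MeasurableSpace Ω] {P : Measure Ω}

/-- A linear subspace `𝒳` of `L⁰`, with its a.s. order and a topology, is a Fréchet lattice
(a completely metrizable, locally solid Riesz space). -/
structure IsFrechetLattice (𝒳 : Submodule ℝ (Ω →ₘ[P] ℝ)) [TopologicalSpace 𝒳] : Prop where
  sup_mem : ∀ X ∈ 𝒳, ∀ Y ∈ 𝒳, X ⊔ Y ∈ 𝒳
  isTopologicalAddGroup : IsTopologicalAddGroup 𝒳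
  continuousSMul : ContinuousSMul ℝ 𝒳
  isCompletelyMetrizable : TopologicalSpace.IsCompletelyMetrizableSpace 𝒳
  locallySolid : ∀ U ∈ 𝓝 (0 : 𝒳), ∃ V ∈ 𝓝 (0 : 𝒳), V ⊆ U ∧
    ∀ X ∈ V, ∀ Y : 𝒳, |(Y : Ω →ₘ[P] ℝ)| ≤ |(X : Ω →ₘ[P] ℝ)| → Y ∈ V

/-- The `σ`-Lebesgue property: `Xₙ ↓ 0` a.s. implies `Xₙ → 0` in `𝒳`. -/
def SigmaLebesgue (𝒳 : Submodule ℝ (Ω →ₘ[P] ℝ)) [TopologicalSpace 𝒳] : Prop :=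
  ∀ X : ℕ → 𝒳, Antitone (fun n => (X n : Ω →ₘ[P] ℝ)) →
    (∀ᵐ ω ∂P, Tendsto (fun n => (X n : Ω →ₘ[P] ℝ) ω) atTop (𝓝 0)) →
    Tendsto X atTop (𝓝 0)

/-- `L^∞` (with the sup-norm) embeds continuously and densely into `𝒳`. -/
def LinftyDenselyEmbedded (𝒳 : Submodule ℝ (Ω →ₘ[P] ℝ)) [TopologicalSpace 𝒳] : Prop :=
  ∃ h : ∀ f : Lp ℝ ∞ P, (f : Ω →ₘ[P] ℝ) ∈ 𝒳,
    Continuous (fun f : Lp ℝ ∞ P => (⟨f, h f⟩ : 𝒳)) ∧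
    DenseRange (fun f : Lp ℝ ∞ P => (⟨f, h f⟩ : 𝒳))

/-- `𝒳` embeds continuously and densely into `L⁰` with the (metrizable) topology of convergence
in probability. -/
def DenselyEmbeddedInL0 (𝒳 : Submodule ℝ (Ω →ₘ[P] ℝ)) [TopologicalSpace 𝒳] : Prop :=
  (∀ X : 𝒳, TendstoInMeasure P (fun Y : 𝒳 => ((Y : Ω →ₘ[P] ℝ) : Ω → ℝ)) (𝓝 X)
    ((X : Ω →ₘ[P] ℝ) : Ω → ℝ)) ∧
  (∀ Y : Ω →ₘ[P] ℝ, ∃ X : ℕ → 𝒳,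
    TendstoInMeasure P (fun n => ((X n : Ω →ₘ[P] ℝ) : Ω → ℝ)) atTop (Y : Ω → ℝ))

/-- The localization property: `1_A 𝒳 ⊆ 𝒳` for every event `A`. -/
def Localization (𝒳 : Submodule ℝ (Ω →ₘ[P] ℝ)) : Prop :=
  ∀ A : Set Ω, ∀ hA : MeasurableSet A, ∀ X ∈ 𝒳,
    AEEqFun.mk (A.indicator (X : Ω → ℝ)) (X.aestronglyMeasurable.indicator hA) ∈ 𝒳

/-- The topology on `𝒳` generated by the functionals `X ↦ E[X Z]`, `Z ∈ L¹`; for `𝒳 = L^∞` this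
is the weak-star topology `σ(L^∞, L¹)`. -/
@[reducible] noncomputable def weakStarTopology (𝒳 : Submodule ℝ (Ω →ₘ[P] ℝ)) : TopologicalSpace 𝒳 :=
  TopologicalSpace.induced
    (fun (X : 𝒳) (Z : Lp ℝ 1 P) => ∫ ω, (X : Ω →ₘ[P] ℝ) ω * Z ω ∂P) Pi.topologicalSpace

/-- The admissible ambient spaces: `L^∞` with the weak-star topology, or a linear subspace of
`L⁰` that is a Fréchet lattice with the `σ`-Lebesgue property, the dense continuous embeddings
`L^∞ ↪ 𝒳 ↪ L⁰` and the localization property. -/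
def IsAmbientSpace (𝒳 : Submodule ℝ (Ω →ₘ[P] ℝ)) [τ : TopologicalSpace 𝒳] : Prop :=
  ((∀ X : Ω →ₘ[P] ℝ, X ∈ 𝒳 ↔ X ∈ Lp ℝ ∞ P) ∧ τ = weakStarTopology 𝒳) ∨
  (IsFrechetLattice 𝒳 ∧ SigmaLebesgue 𝒳 ∧ LinftyDenselyEmbedded 𝒳 ∧ DenselyEmbeddedInL0 𝒳 ∧
    Localization 𝒳)

variable {𝒳 : Submodule ℝ (Ω →ₘ[P] ℝ)}

/-- An acceptance set: a nonempty, strict, monotone subset of `𝒳`. -/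
structure IsAcceptanceSet (𝒜 : Set 𝒳) : Prop where
  nonempty : 𝒜.Nonempty
  ne_univ : 𝒜 ≠ Set.univ
  monotone : ∀ X ∈ 𝒜, ∀ Y : 𝒳, (X : Ω →ₘ[P] ℝ) ≤ (Y : Ω →ₘ[P] ℝ) → Y ∈ 𝒜

/-- Surplus invariance: `X ∈ 𝒜` and `Y⁻ ≤ X⁻` imply `Y ∈ 𝒜`. -/
def IsSurplusInvariant (𝒜 : Set 𝒳) : Prop :=
  ∀ X ∈ 𝒜, ∀ Y : 𝒳, (Y : Ω →ₘ[P] ℝ)⁻ ≤ (X : Ω →ₘ[P] ℝ)⁻ → Y ∈ 𝒜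

/-- `1_A 𝒜 = {1_A X : X ∈ 𝒜}`, as a subset of `𝒳`. -/
def restrict (A : Set Ω) (𝒜 : Set 𝒳) : Set 𝒳 :=
  {Y | ∃ X ∈ 𝒜, ((Y : Ω →ₘ[P] ℝ) : Ω → ℝ) =ᵐ[P] A.indicator ((X : Ω →ₘ[P] ℝ) : Ω → ℝ)}

/-- `𝒳(A) = 1_A 𝒳`. -/
def band (𝒳 : Submodule ℝ (Ω →ₘ[P] ℝ)) (A : Set Ω) : Set 𝒳 :=
  restrict A (Set.univ : Set 𝒳)

/-- `𝒳₊(A) = 𝒳(A) ∩ 𝒳₊`. -/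
def bandPos (𝒳 : Submodule ℝ (Ω →ₘ[P] ℝ)) (A : Set Ω) : Set 𝒳 :=
  band 𝒳 A ∩ {X | 0 ≤ (X : Ω →ₘ[P] ℝ)}

/-- `𝒜^∞ = 𝒜 ∩ L^∞`. -/
def boundedPart (𝒜 : Set 𝒳) : Set (Lp ℝ ∞ P) :=
  {f | ∃ X ∈ 𝒜, (X : Ω →ₘ[P] ℝ) = (f : Ω →ₘ[P] ℝ)}

/-- The lower support function `σ_𝒞(Z) = inf_{X ∈ 𝒞} E[X Z]`. -/
noncomputable def supportFunction (𝒞 : Set (Lp ℝ ∞ P)) (Z : Lp ℝ 1 P) : EReal :=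
  ⨅ X ∈ 𝒞, ((∫ ω, X ω * Z ω ∂P : ℝ) : EReal)

/-- The barrier cone `B(𝒞) = {Z ∈ L¹ : σ_𝒞(Z) > -∞}`. -/
def barrierCone (𝒞 : Set (Lp ℝ ∞ P)) : Set (Lp ℝ 1 P) :=
  {Z | ⊥ < supportFunction 𝒞 Z}

/-- The recession cone `rec(𝒜) = ⋂_{α > 0} α 𝒜`. -/
def recessionCone (𝒜 : Set 𝒳) : Set 𝒳 :=
  ⋂ α ∈ Set.Ioi (0 : ℝ), α • 𝒜

/-- `𝒮 = 𝒰 ⊕ 𝒱`: the elements of `𝒮` are exactly the sums `U + V` with `U ∈ 𝒰`, `V ∈ 𝒱`, and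
`U` and `V` are uniquely determined by the sum. -/
def IsDirectSum (𝒮 𝒰 𝒱 : Set 𝒳) : Prop :=
  Set.BijOn (fun p : 𝒳 × 𝒳 => p.1 + p.2) (𝒰 ×ˢ 𝒱) 𝒮

end SurplusInvariance

/-! The set `C` is where all barrier densities vanish. These densities are nonnegative, because
surplus invariance admits arbitrarily large gains on `{Z < 0}`. A countable weighted sum of
truncated densities is again one, so exhaustion yields a bounded density `w` of maximal support, and
`C = {w = 0}`.

The main point is that acceptability does not depend on values on `C`. In both ambient cases
decreasing a.s. limits are topological limits, so `𝒜` is determined by its truncated losses and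
extends to a subset `hull 𝒜` of `L⁰` that is convex, solid and closed under a.s. limits. Its trace
on `L²` is a closed convex subset of a Hilbert space, so a bounded loss outside it is strictly
separated by some `Z ∈ L² ⊆ L¹`. Such a `Z` is a barrier density, hence zero on `C`, and cannot
distinguish the loss from its restriction to `Cᶜ`. Thus `hull_of_eq_on_compl` holds, and it gives
the first decomposition.

For the second, if every multiple `nX` is acceptable then `n E[min(X⁻, 1) w]` is bounded in `n`, so
`X ≥ 0` on `Cᶜ`. -/

open MeasureTheory Filter Topology
open scoped ENNReal Pointwise

namespace SurplusInvariance
variable {Ω : Type*} [MeasurableSpace Ω] {P : Measure Ω}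

/-! ### Order continuity common to the two kinds of ambient space -/

/-- The properties shared by all admissible ambient spaces: bounded random variables belong to
`𝒳`, which is closed under indicators and suprema, and decreasing a.s. limits within `𝒳` are
topological limits. -/
structure IsOrderContinuousLattice (𝒳 : Submodule ℝ (Ω →ₘ[P] ℝ)) [TopologicalSpace 𝒳] : Prop where
  linfty_mem : ∀ f ∈ Lp ℝ ∞ P, f ∈ 𝒳
  localization : Localization 𝒳
  sup_mem : ∀ X ∈ 𝒳, ∀ Y ∈ 𝒳, X ⊔ Y ∈ 𝒳
  tendsto_of_antitone : ∀ (X : ℕ → 𝒳) (Y : 𝒳), Antitone (fun n => (X n : Ω →ₘ[P] ℝ)) →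
    (∀ᵐ ω ∂P, Tendsto (fun n => (X n : Ω →ₘ[P] ℝ) ω) atTop (𝓝 ((Y : Ω →ₘ[P] ℝ) ω))) →
    Tendsto X atTop (𝓝 Y)

theorem integrable_linfty_mul {f : Ω →ₘ[P] ℝ} (hf : f ∈ Lp ℝ ∞ P) (Z : Lp ℝ 1 P) :
    Integrable (fun ω => f ω * Z ω) P :=
  MemLp.integrable_mul (p := ∞) (q := 1) (Lp.memLp ⟨f, hf⟩) (Lp.memLp Z)

theorem ae_le_of_le {f g : Ω →ₘ[P] ℝ} (h : f ≤ g) : ∀ᵐ ω ∂P, f ω ≤ g ω :=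
  AEEqFun.coeFn_le.2 h

theorem IsFrechetLattice.isOrderContinuousLattice {𝒳 : Submodule ℝ (Ω →ₘ[P] ℝ)}
    [TopologicalSpace 𝒳] (hF : IsFrechetLattice 𝒳) (hS : SigmaLebesgue 𝒳)
    (hD : LinftyDenselyEmbedded 𝒳) (hL : Localization 𝒳) : IsOrderContinuousLattice 𝒳 where
  linfty_mem f hf := by
    obtain ⟨h, -⟩ := hD
    exact h ⟨f, hf⟩
  localization := hL
  sup_mem := hF.sup_mem
  tendsto_of_antitone X Y hX hXY := by
    have := hF.isTopologicalAddGroup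
    have key : Tendsto (fun n => X n - Y) atTop (𝓝 0) := by
      refine hS _ (fun m n hmn => ?_) ?_
      · refine AEEqFun.coeFn_le.1 ?_
        filter_upwards [AEEqFun.coeFn_sub (X m : Ω →ₘ[P] ℝ) Y,
          AEEqFun.coeFn_sub (X n : Ω →ₘ[P] ℝ) Y, ae_le_of_le (hX hmn)] with ω h1 h2 h3
        simpa [h1, h2] using h3
      · have h1 : ∀ᵐ ω ∂P, ∀ n, ((X n - Y : 𝒳) : Ω →ₘ[P] ℝ) ω
            = (X n : Ω →ₘ[P] ℝ) ω - (Y : Ω →ₘ[P] ℝ) ω :=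
          ae_all_iff.2 fun n => AEEqFun.coeFn_sub _ _
        filter_upwards [hXY, h1] with ω h h1
        simp only [h1]
        simpa using h.sub_const ((Y : Ω →ₘ[P] ℝ) ω)
    simpa using key.add_const Y

theorem weakStar_isOrderContinuousLattice (𝒳 : Submodule ℝ (Ω →ₘ[P] ℝ))
    (h : ∀ X : Ω →ₘ[P] ℝ, X ∈ 𝒳 ↔ X ∈ Lp ℝ ∞ P) :
    @IsOrderContinuousLattice _ _ P 𝒳 (weakStarTopology 𝒳) := by
  let := weakStarTopology 𝒳
  refine ⟨fun f hf => (h f).2 hf, fun A hA X hX => ?_, fun X hX Y hY => ?_, fun X Y hX hXY => ?_⟩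
  · rw [h] at hX ⊢
    exact (((Lp.memLp ⟨X, hX⟩ : MemLp X ∞ P).indicator hA).toLp _).2
  · rw [h] at hX hY ⊢
    exact ((⟨X, hX⟩ : Lp ℝ ∞ P) ⊔ ⟨Y, hY⟩).2
  · rw [nhds_induced, tendsto_comap_iff, tendsto_pi_nhds]
    intro Z
    have hX0 := integrable_linfty_mul ((h _).1 (X 0).2) Z
    have hY0 := integrable_linfty_mul ((h _).1 Y.2) Z
    -- Each `X n` lies between the limit `Y` and `X 0`, so `|X 0| + |Y|` times `|Z|` dominates.
    refine tendsto_integral_of_dominated_convergence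
      (fun ω => ‖(X 0 : Ω →ₘ[P] ℝ) ω * Z ω‖ + ‖(Y : Ω →ₘ[P] ℝ) ω * Z ω‖)
      (fun n => (integrable_linfty_mul ((h _).1 (X n).2) Z).1) (hX0.norm.add hY0.norm)
      (fun n => ?_) ?_
    · have hmono : ∀ᵐ ω ∂P, ∀ m n, m ≤ n →
          (X n : Ω →ₘ[P] ℝ) ω ≤ (X m : Ω →ₘ[P] ℝ) ω :=
        ae_all_iff.2 fun m => ae_all_iff.2 fun n => by
          by_cases hmn : m ≤ n
          · filter_upwards [ae_le_of_le (hX hmn)] with ω hω _ using hω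
          · exact Eventually.of_forall fun _ h' => absurd h' hmn
      filter_upwards [hmono, hXY] with ω hm ht
      have h1 := hm 0 n (Nat.zero_le _)
      have h2 : (Y : Ω →ₘ[P] ℝ) ω ≤ (X n : Ω →ₘ[P] ℝ) ω :=
        le_of_tendsto ht (eventually_atTop.2 ⟨n, fun k hk => hm n k hk⟩)
      simp only [norm_mul, Real.norm_eq_abs]
      rw [← add_mul]
      gcongr
      have := abs_le_max_abs_abs h2 h1
      exact this.trans (max_le (le_add_of_nonneg_left (abs_nonneg _))
        (le_add_of_nonneg_right (abs_nonneg _)))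
    · filter_upwards [hXY] with ω hω using hω.mul_const _

theorem IsAmbientSpace.isOrderContinuousLattice {𝒳 : Submodule ℝ (Ω →ₘ[P] ℝ)}
    [τ : TopologicalSpace 𝒳] (h : IsAmbientSpace 𝒳) : IsOrderContinuousLattice 𝒳 := by
  rcases h with ⟨h, rfl⟩ | ⟨hF, hS, hD, -, hL⟩
  · exact weakStar_isOrderContinuousLattice 𝒳 h
  · exact hF.isOrderContinuousLattice hS hD hL

/-! ### Truncated losses and the extension of `𝒜` to `L⁰` -/

section

theorem mk_mem_linfty {g : Ω → ℝ} (hg : AEStronglyMeasurable g P) (c : ℝ)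
    (hc : ∀ᵐ ω ∂P, |g ω| ≤ c) : AEEqFun.mk g hg ∈ Lp ℝ ∞ P :=
  ((memLp_top_of_bound hg c hc).toLp g).2

theorem negPart_ae_eq (f : Ω →ₘ[P] ℝ) : ∀ᵐ ω ∂P, f⁻ ω = max (-f ω) 0 := by
  have h1 : f⁻ = -f ⊔ 0 := rfl
  rw [h1]
  filter_upwards [AEEqFun.coeFn_sup (-f) 0, AEEqFun.coeFn_neg f, AEEqFun.coeFn_zero (β := ℝ) (μ := P)]
    with ω h1 h2 h3
  simp [h1, h2, h3]

theorem neg_neg_sup_ae_eq (f : Ω →ₘ[P] ℝ) : ∀ᵐ ω ∂P, (-(-f ⊔ 0) : Ω →ₘ[P] ℝ) ω = min (f ω) 0 := by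
  filter_upwards [AEEqFun.coeFn_neg (-f ⊔ 0), negPart_ae_eq f] with ω h1 h2
  have h3 : (-f ⊔ 0 : Ω →ₘ[P] ℝ) ω = max (-f ω) 0 := h2
  rw [h1, Pi.neg_apply, h3, ← min_neg_neg, neg_neg, neg_zero]

variable {𝒳 : Submodule ℝ (Ω →ₘ[P] ℝ)} {𝒜 : Set 𝒳}

theorem IsSurplusInvariant.mem_of_ae_le (h : IsSurplusInvariant 𝒜) {X Y : 𝒳} (hX : X ∈ 𝒜)
    (hXY : ∀ᵐ ω ∂P, min ((X : Ω →ₘ[P] ℝ) ω) 0 ≤ (Y : Ω →ₘ[P] ℝ) ω) : Y ∈ 𝒜 := by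
  refine h X hX Y (AEEqFun.coeFn_le.1 ?_)
  filter_upwards [hXY, negPart_ae_eq (X : Ω →ₘ[P] ℝ), negPart_ae_eq (Y : Ω →ₘ[P] ℝ)]
    with ω h1 h2 h3
  rw [h2, h3]
  rcases min_le_iff.1 h1 with h | h
  · exact max_le_max (neg_le_neg h) le_rfl
  · exact max_le (by linarith [le_max_right (-(X : Ω →ₘ[P] ℝ) ω) 0]) (le_max_right _ _)

/-- The truncation of the negative part of `x` at level `n`, with negative sign. -/
def truncNeg (n : ℕ) (x : ℝ) : ℝ := max (min x 0) (-n)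

theorem truncNeg_nonpos (n : ℕ) (x : ℝ) : truncNeg n x ≤ 0 :=
  max_le (min_le_right _ _) (by simp)

theorem neg_le_truncNeg (n : ℕ) (x : ℝ) : -(n : ℝ) ≤ truncNeg n x := le_max_right _ _

theorem min_le_truncNeg (n : ℕ) (x : ℝ) : min x 0 ≤ truncNeg n x := le_max_left _ _

theorem abs_truncNeg_le (n : ℕ) (x : ℝ) : |truncNeg n x| ≤ n :=
  abs_le.2 ⟨neg_le_truncNeg n x, (truncNeg_nonpos n x).trans (Nat.cast_nonneg n)⟩

theorem continuous_truncNeg (n : ℕ) : Continuous (truncNeg n) := by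
  unfold truncNeg; fun_prop

theorem antitone_truncNeg (x : ℝ) : Antitone fun n => truncNeg n x := fun m n h =>
  max_le_max le_rfl (neg_le_neg (by exact_mod_cast h))

theorem truncNeg_mono (n : ℕ) {x y : ℝ} (h : min x 0 ≤ y) : truncNeg n x ≤ truncNeg n y :=
  max_le_max (le_min h (min_le_right _ _)) le_rfl

theorem tendsto_truncNeg (x : ℝ) : Tendsto (fun n => truncNeg n x) atTop (𝓝 (min x 0)) := by
  refine tendsto_const_nhds.congr' ?_
  obtain ⟨N, hN⟩ := exists_nat_ge (-(min x 0))
  filter_upwards [eventually_ge_atTop N] with n hn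
  have : (N : ℝ) ≤ n := by exact_mod_cast hn
  exact (max_eq_left (by linarith)).symm

/-- The random variables all of whose truncated negative parts are acceptable losses. -/
def hull (𝒜 : Set 𝒳) : Set (Ω →ₘ[P] ℝ) :=
  {f | ∀ n : ℕ, ∃ X ∈ 𝒜, ∀ᵐ ω ∂P, (X : Ω →ₘ[P] ℝ) ω = truncNeg n (f ω)}

variable [TopologicalSpace 𝒳]

theorem IsOrderContinuousLattice.exists_of_bounded (h : IsOrderContinuousLattice 𝒳) {g : Ω → ℝ}
    (hg : AEStronglyMeasurable g P) (c : ℝ) (hc : ∀ᵐ ω ∂P, |g ω| ≤ c) :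
    ∃ X : 𝒳, (X : Ω →ₘ[P] ℝ) ∈ Lp ℝ ∞ P ∧ ∀ᵐ ω ∂P, (X : Ω →ₘ[P] ℝ) ω = g ω :=
  ⟨⟨AEEqFun.mk g hg, h.linfty_mem _ (mk_mem_linfty hg c hc)⟩, mk_mem_linfty hg c hc,
    AEEqFun.coeFn_mk g hg⟩

theorem mem_of_tendsto_antitone (h : IsOrderContinuousLattice 𝒳) (hcl : IsClosed 𝒜)
    {X : ℕ → 𝒳} {Y : 𝒳} (hX : ∀ n, X n ∈ 𝒜)
    (hanti : ∀ᵐ ω ∂P, Antitone fun n => (X n : Ω →ₘ[P] ℝ) ω)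
    (hlim : ∀ᵐ ω ∂P, Tendsto (fun n => (X n : Ω →ₘ[P] ℝ) ω) atTop (𝓝 ((Y : Ω →ₘ[P] ℝ) ω))) :
    Y ∈ 𝒜 := by
  refine hcl.mem_of_tendsto (h.tendsto_of_antitone X Y (fun m n hmn => ?_) hlim)
    (Eventually.of_forall hX)
  refine AEEqFun.coeFn_le.1 ?_
  filter_upwards [hanti] with ω hω using hω hmn

theorem mem_hull_of_mem (h : IsOrderContinuousLattice 𝒳) (hs : IsSurplusInvariant 𝒜) {X : 𝒳}
    (hX : X ∈ 𝒜) : (X : Ω →ₘ[P] ℝ) ∈ hull 𝒜 := by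
  intro n
  obtain ⟨Y, -, hY⟩ := h.exists_of_bounded
    ((continuous_truncNeg n).comp_aestronglyMeasurable (X : Ω →ₘ[P] ℝ).aestronglyMeasurable) n
    (Eventually.of_forall fun ω => abs_truncNeg_le n _)
  refine ⟨Y, hs.mem_of_ae_le hX ?_, hY⟩
  filter_upwards [hY] with ω hω
  rw [hω]
  exact min_le_truncNeg _ _

/-- The truncations decrease to `-X⁻`, so closedness gives `-X⁻ ∈ 𝒜`, and surplus invariance passes
from `-X⁻` to `X`. -/
theorem mem_of_mem_hull (h : IsOrderContinuousLattice 𝒳) (hcl : IsClosed 𝒜)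
    (hs : IsSurplusInvariant 𝒜) {X : 𝒳} (hX : (X : Ω →ₘ[P] ℝ) ∈ hull 𝒜) : X ∈ 𝒜 := by
  choose Y hYA hY using hX
  have hmem : -(-(X : Ω →ₘ[P] ℝ) ⊔ 0) ∈ 𝒳 :=
    𝒳.neg_mem (h.sup_mem _ (𝒳.neg_mem X.2) _ 𝒳.zero_mem)
  have hval := neg_neg_sup_ae_eq (X : Ω →ₘ[P] ℝ)
  have hY' : ∀ᵐ ω ∂P, ∀ n, (Y n : Ω →ₘ[P] ℝ) ω = truncNeg n ((X : Ω →ₘ[P] ℝ) ω) :=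
    ae_all_iff.2 hY
  have : (⟨_, hmem⟩ : 𝒳) ∈ 𝒜 := by
    refine mem_of_tendsto_antitone h hcl hYA ?_ ?_
    · filter_upwards [hY'] with ω hω
      simp only [hω]
      exact antitone_truncNeg _
    · filter_upwards [hY', hval] with ω hω h2
      simp only [hω, h2]
      exact tendsto_truncNeg _
  refine hs.mem_of_ae_le this ?_
  filter_upwards [hval] with ω hω
  simp only [hω]
  simp

theorem mem_hull_iff (h : IsOrderContinuousLattice 𝒳) (hcl : IsClosed 𝒜)
    (hs : IsSurplusInvariant 𝒜) {X : 𝒳} : (X : Ω →ₘ[P] ℝ) ∈ hull 𝒜 ↔ X ∈ 𝒜 :=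
  ⟨mem_of_mem_hull h hcl hs, mem_hull_of_mem h hs⟩

theorem hull_solid (h : IsOrderContinuousLattice 𝒳) (hs : IsSurplusInvariant 𝒜)
    {f g : Ω →ₘ[P] ℝ} (hf : f ∈ hull 𝒜) (hfg : ∀ᵐ ω ∂P, min (f ω) 0 ≤ g ω) : g ∈ hull 𝒜 := by
  intro n
  obtain ⟨X, hXA, hX⟩ := hf n
  obtain ⟨Y, -, hY⟩ := h.exists_of_bounded
    ((continuous_truncNeg n).comp_aestronglyMeasurable g.aestronglyMeasurable) n
    (Eventually.of_forall fun ω => abs_truncNeg_le n _)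
  refine ⟨Y, hs.mem_of_ae_le hXA ?_, hY⟩
  filter_upwards [hX, hY, hfg] with ω h1 h2 h3
  rw [h1, h2]
  exact (min_le_left _ _).trans (truncNeg_mono n h3)

/-- The truncations of `f k` need not be monotone in `k`, but their tail suprema are: these dominate
acceptable losses, hence are acceptable, and decrease to the truncation of `g`. -/
theorem hull_of_tendsto (h : IsOrderContinuousLattice 𝒳) (hcl : IsClosed 𝒜)
    (hs : IsSurplusInvariant 𝒜) {f : ℕ → Ω →ₘ[P] ℝ} {g : Ω →ₘ[P] ℝ} (hf : ∀ k, f k ∈ hull 𝒜)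
    (hlim : ∀ᵐ ω ∂P, Tendsto (fun k => f k ω) atTop (𝓝 (g ω))) : g ∈ hull 𝒜 := by
  intro n
  choose X hXA hX using fun k => hf k n
  have hbdd : ∀ k ω, BddAbove (Set.range fun j => truncNeg n (f (k + j) ω)) := fun k ω =>
    ⟨0, by rintro _ ⟨j, rfl⟩; exact truncNeg_nonpos _ _⟩
  have hmeas : ∀ k, Measurable fun ω => ⨆ j, truncNeg n (f (k + j) ω) := fun k =>
    Measurable.iSup fun j => (continuous_truncNeg n).measurable.comp (f (k + j)).measurable
  have hle : ∀ k ω, truncNeg n (f k ω) ≤ ⨆ j, truncNeg n (f (k + j) ω) := fun k ω =>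
    le_ciSup (hbdd k ω) 0
  have hexY : ∀ k, ∃ Y : 𝒳, ∀ᵐ ω ∂P, (Y : Ω →ₘ[P] ℝ) ω = ⨆ j, truncNeg n (f (k + j) ω) :=
    fun k => (h.exists_of_bounded (hmeas k).aestronglyMeasurable n
      (Eventually.of_forall fun ω => abs_le.2 ⟨(neg_le_truncNeg _ _).trans (hle k ω),
        ciSup_le fun j => (truncNeg_nonpos _ _).trans (Nat.cast_nonneg n)⟩)).imp fun _ => And.right
  choose Y hY using hexY
  obtain ⟨W, -, hW⟩ := h.exists_of_bounded
    ((continuous_truncNeg n).comp_aestronglyMeasurable g.aestronglyMeasurable) n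
    (Eventually.of_forall fun ω => abs_truncNeg_le n _)
  refine ⟨W, ?_, hW⟩
  have hYA : ∀ k, Y k ∈ 𝒜 := fun k => by
    refine hs.mem_of_ae_le (hXA k) ?_
    filter_upwards [hX k, hY k] with ω h1 h2
    rw [h1, h2]
    exact (min_le_left _ _).trans (hle k ω)
  have hY' := ae_all_iff.2 hY
  refine mem_of_tendsto_antitone h hcl hYA ?_ ?_
  · filter_upwards [hY'] with ω hω
    simp only [hω]
    refine fun k l hkl => ciSup_le fun j => ?_
    have := le_ciSup (hbdd k ω) (l - k + j)
    rwa [show k + (l - k + j) = l + j by omega] at this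
  · filter_upwards [hY', hW, hlim] with ω hω h2 h3
    simp only [hω, h2]
    have h4 : Tendsto (fun k => truncNeg n (f k ω)) atTop (𝓝 (truncNeg n (g ω))) :=
      ((continuous_truncNeg n).tendsto _).comp h3
    refine tendsto_order.2 ⟨fun a ha => ?_, fun a ha => ?_⟩
    · filter_upwards [(tendsto_order.1 h4).1 a ha] with k hk using hk.trans_le (hle k ω)
    · obtain ⟨b, hb, hba⟩ := exists_between ha
      obtain ⟨N, hN⟩ := eventually_atTop.1 ((tendsto_order.1 h4).2 b hb)
      filter_upwards [eventually_ge_atTop N] with k hk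
      exact (ciSup_le fun j => (hN (k + j) (by omega)).le).trans_lt hba

theorem hull_convex (h : IsOrderContinuousLattice 𝒳) (hcl : IsClosed 𝒜) (hcv : Convex ℝ 𝒜)
    (hs : IsSurplusInvariant 𝒜) : Convex ℝ (hull 𝒜) := by
  intro f hf g hg a b ha hb hab
  choose X hXA hX using hf
  choose Y hYA hY using hg
  have hm : AEStronglyMeasurable (fun ω => a * min (f ω) 0 + b * min (g ω) 0) P := by
    have h1 := f.aestronglyMeasurable
    have h2 := g.aestronglyMeasurable
    exact ((h1.inf aestronglyMeasurable_const).const_mul a).add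
      ((h2.inf aestronglyMeasurable_const).const_mul b)
  -- The combination of the negative parts is the a.s. limit of combinations of truncations, which
  -- stay in `𝒜`. The combination of `f` and `g` lies above it.
  have key : AEEqFun.mk _ hm ∈ hull 𝒜 := by
    refine hull_of_tendsto h hcl hs (f := fun m => ((a • X m + b • Y m : 𝒳) : Ω →ₘ[P] ℝ))
      (fun m => mem_hull_of_mem h hs (hcv (hXA m) (hYA m) ha hb hab)) ?_
    have h1 : ∀ᵐ ω ∂P, ∀ m, ((a • X m + b • Y m : 𝒳) : Ω →ₘ[P] ℝ) ω
        = a * truncNeg m (f ω) + b * truncNeg m (g ω) := by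
      refine ae_all_iff.2 fun m => ?_
      filter_upwards [AEEqFun.coeFn_add (a • (X m : Ω →ₘ[P] ℝ)) (b • (Y m : Ω →ₘ[P] ℝ)),
        AEEqFun.coeFn_smul a (X m : Ω →ₘ[P] ℝ), AEEqFun.coeFn_smul b (Y m : Ω →ₘ[P] ℝ),
        hX m, hY m] with ω h1 h2 h3 h4 h5
      rw [← h4, ← h5]
      simpa [h2, h3] using h1
    filter_upwards [h1, AEEqFun.coeFn_mk _ hm] with ω h1 h2
    simp only [h1, h2]
    exact ((tendsto_truncNeg _).const_mul a).add ((tendsto_truncNeg _).const_mul b)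
  refine hull_solid h hs key ?_
  filter_upwards [AEEqFun.coeFn_mk _ hm, AEEqFun.coeFn_add (a • f) (b • g),
        AEEqFun.coeFn_smul a f, AEEqFun.coeFn_smul b g] with ω h1 h2 h3 h4
  rw [h1, h2, Pi.add_apply, h3, h4]
  simp only [Pi.smul_apply, smul_eq_mul]
  exact (min_le_left _ _).trans (add_le_add
    (mul_le_mul_of_nonneg_left (min_le_left _ _) ha)
    (mul_le_mul_of_nonneg_left (min_le_left _ _) hb))

end

/-! ### Separation in `L²` and irrelevance of values on `C` -/

section

variable {𝒳 : Submodule ℝ (Ω →ₘ[P] ℝ)} {𝒜 : Set 𝒳}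

theorem mem_barrierCone_iff {Z : Lp ℝ 1 P} : Z ∈ barrierCone (boundedPart 𝒜) ↔
    ∃ M : ℝ, ∀ X ∈ 𝒜, (X : Ω →ₘ[P] ℝ) ∈ Lp ℝ ∞ P → M ≤ ∫ ω, (X : Ω →ₘ[P] ℝ) ω * Z ω ∂P := by
  constructor
  · intro hZ
    obtain ⟨M, -, hM⟩ := EReal.lt_iff_exists_real_btwn.1 (show ⊥ < supportFunction _ Z from hZ)
    refine ⟨M, fun X hX hXb => ?_⟩
    have := hM.le.trans (iInf₂_le (⟨X, hXb⟩ : Lp ℝ ∞ P) ⟨X, hX, rfl⟩)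
    exact EReal.coe_le_coe_iff.1 this
  · rintro ⟨M, hM⟩
    refine (EReal.bot_lt_coe M).trans_le (le_iInf₂ fun f hf => ?_)
    obtain ⟨X, hX, hXf⟩ := hf
    rw [EReal.coe_le_coe_iff, ← hXf]
    exact hM X hX (hXf ▸ f.2)

variable [TopologicalSpace 𝒳]

/-- Convergence in `L²` has an a.s. convergent subsequence, so the trace of `hull 𝒜` on `L²` is
closed. Hahn–Banach separates, and the Riesz representation turns the functional into a density. -/
theorem exists_separating [IsProbabilityMeasure P] (h : IsOrderContinuousLattice 𝒳)
    (hcl : IsClosed 𝒜) (hcv : Convex ℝ 𝒜) (hs : IsSurplusInvariant 𝒜) {g : Ω →ₘ[P] ℝ}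
    (hg2 : g ∈ Lp ℝ 2 P) (hg : g ∉ hull 𝒜) :
    ∃ (Z : Lp ℝ 2 P) (u : ℝ), ∫ ω, g ω * Z ω ∂P < u ∧
      ∀ f ∈ hull 𝒜, f ∈ Lp ℝ 2 P → u < ∫ ω, f ω * Z ω ∂P := by
  have hconv : Convex ℝ {f : Lp ℝ 2 P | (f : Ω →ₘ[P] ℝ) ∈ hull 𝒜} := by
    intro x hx y hy a b ha hb hab
    exact hull_convex h hcl hcv hs hx hy ha hb hab
  have hclosed : IsClosed {f : Lp ℝ 2 P | (f : Ω →ₘ[P] ℝ) ∈ hull 𝒜} := by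
    refine IsSeqClosed.isClosed fun f g hf hfg => ?_
    obtain ⟨ns, -, hns⟩ := (tendstoInMeasure_of_tendsto_Lp hfg).exists_seq_tendsto_ae
    exact hull_of_tendsto h hcl hs (fun k => hf (ns k)) hns
  obtain ⟨φ, u, h1, h2⟩ := geometric_hahn_banach_point_closed hconv hclosed
    (x := (⟨g, hg2⟩ : Lp ℝ 2 P)) hg
  have hφ : ∀ f : Lp ℝ 2 P,
      φ f = ∫ ω, f ω * (InnerProductSpace.toDual ℝ (Lp ℝ 2 P)).symm φ ω ∂P := fun f => by
    rw [← InnerProductSpace.toDual_symm_apply, L2.inner_def]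
    simp
  refine ⟨(InnerProductSpace.toDual ℝ (Lp ℝ 2 P)).symm φ, u, ?_, fun f hf hf2 => ?_⟩
  · rw [hφ] at h1
    exact h1
  · have := h2 ⟨f, hf2⟩ hf
    rw [hφ] at this
    exact this

theorem hull_of_eq_on_compl [IsProbabilityMeasure P] (h : IsOrderContinuousLattice 𝒳)
    (hcl : IsClosed 𝒜) (hcv : Convex ℝ 𝒜) (hs : IsSurplusInvariant 𝒜) {C : Set Ω}
    (hCm : MeasurableSet C)
    (hC : ∀ Z ∈ barrierCone (boundedPart 𝒜), ∀ᵐ ω ∂P, ω ∈ C → Z ω = 0)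
    {f g : Ω →ₘ[P] ℝ} (hf : f ∈ hull 𝒜) (hfg : ∀ᵐ ω ∂P, ω ∉ C → g ω = f ω) : g ∈ hull 𝒜 := by
  have hm : ∀ n, AEStronglyMeasurable (fun ω => truncNeg n (g ω)) P := fun n =>
    (continuous_truncNeg n).comp_aestronglyMeasurable g.aestronglyMeasurable
  suffices htrunc : ∀ n, AEEqFun.mk _ (hm n) ∈ hull 𝒜 by
    have hmin : AEStronglyMeasurable (fun ω => min (g ω) 0) P :=
      g.aestronglyMeasurable.inf aestronglyMeasurable_const
    refine hull_solid h hs (f := AEEqFun.mk _ hmin) (hull_of_tendsto h hcl hs htrunc ?_) ?_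
    · filter_upwards [ae_all_iff.2 fun n => AEEqFun.coeFn_mk _ (hm n),
        AEEqFun.coeFn_mk _ hmin] with ω h1 h2
      simp only [h1, h2]
      exact tendsto_truncNeg _
    · filter_upwards [AEEqFun.coeFn_mk _ hmin] with ω h1
      rw [h1]
      exact (min_le_left _ _).trans (min_le_left _ _)
  intro n
  by_contra hn
  have hL2 : ∀ X : Ω →ₘ[P] ℝ, X ∈ Lp ℝ ∞ P → X ∈ Lp ℝ 2 P := fun X hX =>
    Lp.antitone le_top hX
  obtain ⟨Z, u, hZ1, hZ2⟩ := exists_separating h hcl hcv hs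
    (hL2 _ (mk_mem_linfty (hm n) n (Eventually.of_forall fun ω => abs_truncNeg_le n _))) hn
  have hZmem : MemLp Z 1 P := (Lp.memLp Z).mono_exponent (by norm_num)
  -- Bounded acceptable positions lie in the separated set, so `u` bounds their expectations from
  -- below.
  have hZB : hZmem.toLp Z ∈ barrierCone (boundedPart 𝒜) := by
    refine mem_barrierCone_iff.2 ⟨u, fun X hX hXb => ?_⟩
    refine (hZ2 X (mem_hull_of_mem h hs hX) (hL2 _ hXb)).le.trans_eq (integral_congr_ae ?_)
    filter_upwards [hZmem.coeFn_toLp] with ω hω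
    rw [hω]
  have hm' : AEStronglyMeasurable (Cᶜ.indicator fun ω => truncNeg n (g ω)) P :=
    (hm n).indicator hCm.compl
  have hmem : AEEqFun.mk _ hm' ∈ hull 𝒜 := by
    refine hull_solid h hs hf ?_
    filter_upwards [AEEqFun.coeFn_mk _ hm', hfg] with ω h1 h2
    rw [h1]
    by_cases hω : ω ∈ C
    · simp [hω]
    · rw [Set.indicator_of_mem (by simpa using hω), h2 hω]
      exact min_le_truncNeg _ _
  have hbd : ∀ ω, |Cᶜ.indicator (fun ω => truncNeg n (g ω)) ω| ≤ n := fun ω => by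
    by_cases hω : ω ∈ C
    · simp [hω]
    · rw [Set.indicator_of_mem (by simpa using hω)]
      exact abs_truncNeg_le n _
  -- The truncation restricted to `Cᶜ` is in the hull, yet has the same integral against `Z` as the
  -- truncation itself, since `Z = 0` on `C`.
  refine absurd (hZ2 _ hmem (hL2 _ (mk_mem_linfty hm' n (Eventually.of_forall hbd))))
    (not_lt.2 ?_)
  refine le_of_eq_of_le (integral_congr_ae ?_) hZ1.le
  filter_upwards [AEEqFun.coeFn_mk _ hm', AEEqFun.coeFn_mk _ (hm n), hC _ hZB,
    hZmem.coeFn_toLp] with ω h1 h2 h3 h4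
  rw [h1, h2]
  by_cases hω : ω ∈ C
  · rw [← h4, h3 hω, mul_zero, mul_zero]
  · rw [Set.indicator_of_mem (by simpa using hω)]

end

/-! ### Barrier weights and a weight of maximal support -/

section

variable {𝒳 : Submodule ℝ (Ω →ₘ[P] ℝ)} {𝒜 : Set 𝒳}

/-- Nonnegative weights bounded by one against which the losses of the bounded acceptable
positions have uniformly bounded expectation. -/
def IsBarrierWeight (𝒜 : Set 𝒳) (z : Ω → ℝ≥0∞) : Prop :=
  Measurable z ∧ (∀ ω, z ω ≤ 1) ∧ ∃ M : ℝ≥0∞, M ≠ ∞ ∧ ∀ X ∈ 𝒜, (X : Ω →ₘ[P] ℝ) ∈ Lp ℝ ∞ P →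
    ∫⁻ ω, ENNReal.ofReal (-(X : Ω →ₘ[P] ℝ) ω) * z ω ∂P ≤ M

theorem isBarrierWeight_zero (𝒜 : Set 𝒳) : IsBarrierWeight 𝒜 0 :=
  ⟨measurable_zero, fun _ => zero_le_one, 0, by simp, by simp⟩

theorem IsBarrierWeight.exists_combination {z : ℕ → Ω → ℝ≥0∞}
    (hz : ∀ n, IsBarrierWeight 𝒜 (z n)) :
    ∃ w, IsBarrierWeight 𝒜 w ∧ ∀ n ω, z n ω ≠ 0 → w ω ≠ 0 := by
  choose hzm hz1 M hM hzM using hz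
  -- Summability against `M n + 1` serves twice: the summand `1` keeps the combined weight below
  -- one, and `M n` bounds the expected losses.
  obtain ⟨δ, hδ, hsum⟩ := ENNReal.exists_pos_tsum_mul_lt_of_countable one_ne_zero
    (fun n => M n + 1) (fun n => ENNReal.add_ne_top.2 ⟨hM n, ENNReal.one_ne_top⟩)
  refine ⟨fun ω => ∑' n, δ n * z n ω, ⟨?_, fun ω => ?_, 1, ENNReal.one_ne_top, ?_⟩, ?_⟩
  · exact Measurable.tsum fun n => (hzm n).const_mul _
  · refine (ENNReal.tsum_le_tsum fun n => ?_).trans hsum.le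
    rw [mul_comm]
    gcongr
    exact (hz1 n ω).trans le_add_self
  · intro X hX hXb
    have hXm : Measurable fun ω => ENNReal.ofReal (-(X : Ω →ₘ[P] ℝ) ω) :=
      (X : Ω →ₘ[P] ℝ).measurable.neg.ennreal_ofReal
    simp_rw [← ENNReal.tsum_mul_left]
    have hm : ∀ n, AEMeasurable
        (fun ω => ENNReal.ofReal (-(X : Ω →ₘ[P] ℝ) ω) * ((δ n : ℝ≥0∞) * z n ω)) P :=
      fun n => (hXm.mul ((hzm n).const_mul _)).aemeasurable
    rw [lintegral_tsum hm]
    refine (ENNReal.tsum_le_tsum fun n => ?_).trans hsum.le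
    simp_rw [mul_left_comm _ (δ n : ℝ≥0∞)]
    have hmn : Measurable fun ω => ENNReal.ofReal (-(X : Ω →ₘ[P] ℝ) ω) * z n ω :=
      hXm.mul (hzm n)
    rw [lintegral_const_mul _ hmn, mul_comm]
    gcongr
    exact (hzM n X hX hXb).trans le_self_add
  · intro n ω hn h0
    have := ENNReal.tsum_eq_zero.1 h0 n
    rcases mul_eq_zero.1 this with h | h
    · exact (hδ n).ne' (by exact_mod_cast h)
    · exact hn h

/-- Exhaustion: combining a maximizing sequence gives a `w` whose support attains the supremum of
the probabilities. Combining `w` with any `z` cannot enlarge that support beyond a null set. -/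
theorem exists_maximal_barrierWeight [IsProbabilityMeasure P] (𝒜 : Set 𝒳) :
    ∃ w, IsBarrierWeight 𝒜 w ∧
      ∀ z, IsBarrierWeight 𝒜 z → ∀ᵐ ω ∂P, w ω = 0 → z ω = 0 := by
  set S : Set ℝ≥0∞ := (fun z => P {ω | z ω ≠ 0}) '' {z | IsBarrierWeight 𝒜 z}
  have hSne : S.Nonempty := ⟨_, 0, isBarrierWeight_zero 𝒜, rfl⟩
  obtain ⟨u, -, hu, huS⟩ := exists_seq_tendsto_sSup hSne (OrderTop.bddAbove S)
  choose z hz hzu using huS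
  obtain ⟨w, hw, hwz⟩ := IsBarrierWeight.exists_combination hz
  have hsup : sSup S ≤ P {ω | w ω ≠ 0} :=
    le_of_tendsto' hu fun n => hzu n ▸ measure_mono fun ω hω => hwz n ω hω
  refine ⟨w, hw, fun z' hz' => ?_⟩
  obtain ⟨v, hv, hvz⟩ := IsBarrierWeight.exists_combination
    (z := fun n => if n = 0 then w else z') (fun n => by split_ifs <;> assumption)
  have hwv : {ω | w ω ≠ 0} ⊆ {ω | v ω ≠ 0} := fun ω hω => hvz 0 ω (by simpa using hω)
  have hzv : {ω | z' ω ≠ 0} ⊆ {ω | v ω ≠ 0} := fun ω hω => hvz 1 ω (by simpa using hω)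
  have hvS : P {ω | v ω ≠ 0} ≤ sSup S := le_sSup ⟨v, hv, rfl⟩
  have hae := ae_eq_of_subset_of_measure_ge hwv (hvS.trans hsup)
    (measurableSet_eq_fun hw.1 measurable_const).compl.nullMeasurableSet (measure_ne_top _ _)
  filter_upwards [hae.mem_iff] with ω hω h0
  by_contra hne
  exact hω.2 (hzv hne) h0

theorem IsBarrierWeight.exists_mem_barrierCone [IsProbabilityMeasure P] {z : Ω → ℝ≥0∞}
    (hz : IsBarrierWeight 𝒜 z) :
    ∃ Z ∈ barrierCone (boundedPart 𝒜), MemLp Z ∞ P ∧ ∀ᵐ ω ∂P, Z ω = (z ω).toReal := by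
  obtain ⟨hzm, hz1, M, hM, hzM⟩ := hz
  have hbd : MemLp (fun ω => (z ω).toReal) ∞ P :=
    memLp_top_of_bound hzm.ennreal_toReal.aestronglyMeasurable 1 (Eventually.of_forall fun ω => by
      rw [Real.norm_of_nonneg ENNReal.toReal_nonneg]
      exact ENNReal.toReal_le_of_le_ofReal zero_le_one (by simpa using hz1 ω))
  have h1 : MemLp (fun ω => (z ω).toReal) 1 P := hbd.mono_exponent le_top
  refine ⟨h1.toLp _, ?_, (memLp_congr_ae h1.coeFn_toLp).2 hbd, h1.coeFn_toLp⟩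
  refine mem_barrierCone_iff.2 ⟨-M.toReal, fun X hX hXb => ?_⟩
  rw [integral_eq_lintegral_pos_part_sub_lintegral_neg_part (integrable_linfty_mul hXb _)]
  have : ∫⁻ ω, ENNReal.ofReal (-((X : Ω →ₘ[P] ℝ) ω * (h1.toLp _ : Lp ℝ 1 P) ω)) ∂P ≤ M := by
    refine le_of_eq_of_le (lintegral_congr_ae ?_) (hzM X hX hXb)
    filter_upwards [h1.coeFn_toLp] with ω hω
    rw [hω, ← neg_mul, ENNReal.ofReal_mul' ENNReal.toReal_nonneg,
      ENNReal.ofReal_toReal ((hz1 ω).trans_lt ENNReal.one_lt_top).ne]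
  have h2 := ENNReal.toReal_mono hM this
  have h3 : 0 ≤ (∫⁻ ω, ENNReal.ofReal
    ((X : Ω →ₘ[P] ℝ) ω * (h1.toLp _ : Lp ℝ 1 P) ω) ∂P).toReal := ENNReal.toReal_nonneg
  linarith

variable [TopologicalSpace 𝒳]

/-- The position `n 1_{Z < 0}` is acceptable for every `n`, and its pairing with `Z` is `-n E[Z⁻]`,
bounded below only if `E[Z⁻] = 0`. -/
theorem barrierCone_nonneg (h : IsOrderContinuousLattice 𝒳) (hne : 𝒜.Nonempty)
    (hs : IsSurplusInvariant 𝒜) {Z : Lp ℝ 1 P} (hZ : Z ∈ barrierCone (boundedPart 𝒜)) :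
    ∀ᵐ ω ∂P, 0 ≤ Z ω := by
  obtain ⟨X₀, hX₀⟩ := hne
  obtain ⟨M, hM⟩ := mem_barrierCone_iff.1 hZ
  have hZi : Integrable Z P := memLp_one_iff_integrable.1 (Lp.memLp Z)
  have hD : MeasurableSet {ω | Z ω < 0} :=
    (Lp.stronglyMeasurable Z).measurable measurableSet_Iio
  have key : ∀ n : ℕ, n * ∫ ω, max (-Z ω) 0 ∂P ≤ -M := fun n => by
    obtain ⟨X, hXb, hX⟩ := h.exists_of_bounded (P := P)
      (g := {ω | Z ω < 0}.indicator fun _ => (n : ℝ))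
      (aestronglyMeasurable_const.indicator hD) n (Eventually.of_forall fun ω => by
        by_cases hω : Z ω < 0 <;> simp [Set.indicator, hω])
    have hXA : X ∈ 𝒜 := hs.mem_of_ae_le hX₀ (by
      filter_upwards [hX] with ω hω
      rw [hω]
      exact (min_le_right _ _).trans (Set.indicator_nonneg (fun _ _ => Nat.cast_nonneg n) ω))
    have h1 : ∫ ω, (X : Ω →ₘ[P] ℝ) ω * Z ω ∂P = -(n * ∫ ω, max (-Z ω) 0 ∂P) := by
      rw [← integral_const_mul, ← integral_neg]
      refine integral_congr_ae ?_
      filter_upwards [hX] with ω hω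
      rw [hω]
      by_cases h0 : Z ω < 0
      · simp [Set.indicator, h0, max_eq_left (neg_pos.2 h0).le]
      · simp [Set.indicator, h0, max_eq_right (neg_nonpos.2 (not_lt.1 h0))]
    have h2 := hM X hXA hXb
    linarith
  have hint : Integrable (fun ω => max (-Z ω) 0) P := hZi.neg_part
  have hnn : 0 ≤ ∫ ω, max (-Z ω) 0 ∂P := integral_nonneg fun ω => le_max_right _ _
  have hzero : ∫ ω, max (-Z ω) 0 ∂P = 0 := by
    by_contra hne
    obtain ⟨n, hn⟩ := exists_lt_nsmul (lt_of_le_of_ne hnn (Ne.symm hne)) (-M)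
    rw [nsmul_eq_mul] at hn
    exact absurd (key n) (not_le.2 hn)
  filter_upwards [(integral_eq_zero_iff_of_nonneg (fun ω => le_max_right _ _) hint).1 hzero]
    with ω hω
  have : -Z ω ≤ 0 := (le_max_left _ _).trans hω.le
  linarith

/-- Testing `Z` on `-X⁻`, which is acceptable together with `X`, bounds `E[X⁻ Z]`; capping `Z` at
one only lowers this and keeps its support. -/
theorem isBarrierWeight_of_mem_barrierCone (h : IsOrderContinuousLattice 𝒳) (hne : 𝒜.Nonempty)
    (hs : IsSurplusInvariant 𝒜) {Z : Lp ℝ 1 P} (hZ : Z ∈ barrierCone (boundedPart 𝒜)) :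
    IsBarrierWeight 𝒜 fun ω => min (ENNReal.ofReal (Z ω)) 1 := by
  have hZ0 := barrierCone_nonneg h hne hs hZ
  obtain ⟨M, hM⟩ := mem_barrierCone_iff.1 hZ
  refine ⟨(Lp.stronglyMeasurable Z).measurable.ennreal_ofReal.min measurable_const,
    fun ω => min_le_right _ _, ENNReal.ofReal (-M), ENNReal.ofReal_ne_top, fun X hX hXb => ?_⟩
  have hYb : -(-(X : Ω →ₘ[P] ℝ) ⊔ 0) ∈ Lp ℝ ∞ P := (-(-(⟨X, hXb⟩ : Lp ℝ ∞ P) ⊔ 0)).2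
  have hval := neg_neg_sup_ae_eq (X : Ω →ₘ[P] ℝ)
  have hYA : (⟨_, h.linfty_mem _ hYb⟩ : 𝒳) ∈ 𝒜 := hs.mem_of_ae_le hX (by
    filter_upwards [hval] with ω hω using hω.ge)
  have hle := hM _ hYA hYb
  have hint := (integrable_linfty_mul hYb Z).neg
  calc ∫⁻ ω, ENNReal.ofReal (-(X : Ω →ₘ[P] ℝ) ω) * min (ENNReal.ofReal (Z ω)) 1 ∂P
      ≤ ∫⁻ ω, ENNReal.ofReal (-((-(-(X : Ω →ₘ[P] ℝ) ⊔ 0) : Ω →ₘ[P] ℝ) ω * Z ω)) ∂P := by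
        refine lintegral_mono_ae ?_
        filter_upwards [hval, hZ0] with ω h1 h2
        rw [h1, ← neg_mul, ENNReal.ofReal_mul' h2]
        gcongr
        · exact min_le_left _ _
        · exact min_le_left _ _
    _ = ENNReal.ofReal (∫ ω, -((-(-(X : Ω →ₘ[P] ℝ) ⊔ 0) : Ω →ₘ[P] ℝ) ω * Z ω) ∂P) := by
        refine (ofReal_integral_eq_lintegral_ofReal hint ?_).symm
        filter_upwards [hval, hZ0] with ω h1 h2
        simp only [Pi.zero_apply, Pi.neg_apply]
        rw [h1, ← neg_mul]
        exact mul_nonneg (neg_nonneg.2 (min_le_right _ _)) h2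
    _ ≤ ENNReal.ofReal (-M) := by
        rw [integral_neg]
        exact ENNReal.ofReal_le_ofReal (neg_le_neg hle)

end

/-! ### Bands, direct sums and the recession cone -/

section

variable {𝒳 : Submodule ℝ (Ω →ₘ[P] ℝ)} {𝒜 : Set 𝒳}

theorem coeFn_add_ae (U V : 𝒳) : ∀ᵐ ω ∂P, ((U + V : 𝒳) : Ω →ₘ[P] ℝ) ω
    = (U : Ω →ₘ[P] ℝ) ω + (V : Ω →ₘ[P] ℝ) ω :=
  AEEqFun.coeFn_add _ _

theorem coeFn_smul_ae (t : ℝ) (U : 𝒳) : ∀ᵐ ω ∂P, ((t • U : 𝒳) : Ω →ₘ[P] ℝ) ω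
    = t * (U : Ω →ₘ[P] ℝ) ω :=
  AEEqFun.coeFn_smul _ _

theorem mem_band_iff {A : Set Ω} {X : 𝒳} :
    X ∈ band 𝒳 A ↔ ∀ᵐ ω ∂P, ω ∉ A → (X : Ω →ₘ[P] ℝ) ω = 0 := by
  constructor
  · rintro ⟨Y, -, hY⟩
    filter_upwards [hY] with ω hω hA
    rw [hω, Set.indicator_of_notMem hA]
  · intro hX
    refine ⟨X, Set.mem_univ _, ?_⟩
    filter_upwards [hX] with ω hω
    by_cases hA : ω ∈ A
    · rw [Set.indicator_of_mem hA]
    · rw [Set.indicator_of_notMem hA, hω hA]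

theorem restrict_subset_band (A : Set Ω) (𝒜 : Set 𝒳) : restrict A 𝒜 ⊆ band 𝒳 A := by
  rintro Y ⟨X, -, hX⟩
  exact ⟨X, Set.mem_univ _, hX⟩

theorem Localization.exists_indicator (h : Localization 𝒳) {A : Set Ω} (hA : MeasurableSet A)
    (X : 𝒳) : ∃ Y : 𝒳, ∀ᵐ ω ∂P, (Y : Ω →ₘ[P] ℝ) ω = A.indicator (X : Ω →ₘ[P] ℝ) ω :=
  ⟨⟨_, h A hA X X.2⟩, AEEqFun.coeFn_mk _ _⟩

theorem isDirectSum_band (h : Localization 𝒳) {C : Set Ω} (hC : MeasurableSet C) {𝒮 𝒱 : Set 𝒳}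
    (h𝒱 : 𝒱 ⊆ band 𝒳 Cᶜ) (hadd : ∀ U ∈ band 𝒳 C, ∀ V ∈ 𝒱, U + V ∈ 𝒮)
    (hind : ∀ X ∈ 𝒮, ∀ V : 𝒳,
      (∀ᵐ ω ∂P, (V : Ω →ₘ[P] ℝ) ω = Cᶜ.indicator (X : Ω →ₘ[P] ℝ) ω) → V ∈ 𝒱) :
    IsDirectSum 𝒮 (band 𝒳 C) 𝒱 := by
  refine ⟨fun p hp => hadd _ hp.1 _ hp.2, fun p hp q hq hpq => ?_, fun X hX => ?_⟩
  · have hpq' : p.1 + p.2 = q.1 + q.2 := hpq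
    have h1 : p.1 = q.1 := by
      refine Subtype.ext (AEEqFun.ext ?_)
      have hs := coeFn_add_ae p.1 p.2
      rw [hpq'] at hs
      filter_upwards [hs, coeFn_add_ae q.1 q.2, mem_band_iff.1 hp.1, mem_band_iff.1 hq.1,
        mem_band_iff.1 (h𝒱 hp.2), mem_band_iff.1 (h𝒱 hq.2)] with ω h1 h2 h3 h4 h5 h6
      by_cases hω : ω ∈ C
      · rw [h5 (by simpa using hω)] at h1
        rw [h6 (by simpa using hω)] at h2
        linarith
      · rw [h3 hω, h4 hω]
    rw [h1] at hpq'
    exact Prod.ext h1 (add_left_cancel hpq')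
  · obtain ⟨U, hU⟩ := h.exists_indicator hC X
    obtain ⟨V, hV⟩ := h.exists_indicator hC.compl X
    refine ⟨(U, V), ⟨⟨X, Set.mem_univ _, hU⟩, hind X hX V hV⟩, Subtype.ext (AEEqFun.ext ?_)⟩
    filter_upwards [coeFn_add_ae U V, hU, hV] with ω h1 h2 h3
    rw [h1, h2, h3]
    exact congrFun (Set.indicator_self_add_compl C _) ω

theorem mem_recessionCone_iff {X : 𝒳} :
    X ∈ recessionCone 𝒜 ↔ ∀ t : ℝ, 0 < t → t • X ∈ 𝒜 := by
  simp only [recessionCone, Set.mem_iInter₂, Set.mem_Ioi]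
  constructor
  · intro h t ht
    have := (Set.mem_smul_set_iff_inv_smul_mem₀ (inv_pos.2 ht).ne' _ _).1 (h t⁻¹ (inv_pos.2 ht))
    rwa [inv_inv] at this
  · intro h t ht
    exact (Set.mem_smul_set_iff_inv_smul_mem₀ ht.ne' _ _).2 (h _ (inv_pos.2 ht))

variable [TopologicalSpace 𝒳]

/-- The bounded position `-n min(X⁻, 1)` lies above `-(nX)⁻`, hence is acceptable, so `n E[min(X⁻,
1) z] ≤ M` for all `n` and the expectation is zero. -/
theorem IsBarrierWeight.nonneg_of_mem_recessionCone (h : IsOrderContinuousLattice 𝒳)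
    (hs : IsSurplusInvariant 𝒜) {z : Ω → ℝ≥0∞} (hz : IsBarrierWeight 𝒜 z)
    {X : 𝒳} (hX : X ∈ recessionCone 𝒜) : ∀ᵐ ω ∂P, z ω ≠ 0 → 0 ≤ (X : Ω →ₘ[P] ℝ) ω := by
  obtain ⟨hzm, -, M, hM, hzM⟩ := hz
  have hm : Measurable fun ω => truncNeg 1 ((X : Ω →ₘ[P] ℝ) ω) :=
    (continuous_truncNeg 1).measurable.comp (X : Ω →ₘ[P] ℝ).measurable
  have hIm : Measurable fun ω => ENNReal.ofReal (-truncNeg 1 ((X : Ω →ₘ[P] ℝ) ω)) * z ω :=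
    hm.neg.ennreal_ofReal.mul hzm
  have key : ∀ n : ℕ,
      n * ∫⁻ ω, ENNReal.ofReal (-truncNeg 1 ((X : Ω →ₘ[P] ℝ) ω)) * z ω ∂P ≤ M := fun n => by
    rcases n.eq_zero_or_pos with rfl | hn
    · simp
    have hnX := mem_recessionCone_iff.1 hX n (by exact_mod_cast hn)
    obtain ⟨Y, hYb, hY⟩ := h.exists_of_bounded (hm.const_mul (n : ℝ)).aestronglyMeasurable n
      (Eventually.of_forall fun ω => by
        rw [abs_mul, Nat.abs_cast]
        exact mul_le_of_le_one_right (Nat.cast_nonneg n)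
          (by simpa using abs_truncNeg_le 1 ((X : Ω →ₘ[P] ℝ) ω)))
    have hYA : Y ∈ 𝒜 := hs.mem_of_ae_le hnX (by
      filter_upwards [hY, coeFn_smul_ae (n : ℝ) X] with ω h1 h2
      rw [h1, h2]
      have := mul_le_mul_of_nonneg_left (min_le_truncNeg 1 ((X : Ω →ₘ[P] ℝ) ω))
        (Nat.cast_nonneg n : (0 : ℝ) ≤ n)
      rwa [mul_min_of_nonneg _ _ (Nat.cast_nonneg n), mul_zero] at this)
    refine le_of_eq_of_le ?_ (hzM Y hYA hYb)
    rw [← lintegral_const_mul _ hIm]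
    refine lintegral_congr_ae ?_
    filter_upwards [hY] with ω hω
    rw [hω, ← mul_neg, ENNReal.ofReal_mul (Nat.cast_nonneg n), ENNReal.ofReal_natCast, mul_assoc]
  have hzero : ∫⁻ ω, ENNReal.ofReal (-truncNeg 1 ((X : Ω →ₘ[P] ℝ) ω)) * z ω ∂P = 0 := by
    by_contra hne
    obtain ⟨n, hn⟩ := ENNReal.exists_nat_mul_gt hne hM
    exact absurd (key n) (not_le.2 hn)
  filter_upwards [(lintegral_eq_zero_iff hIm).1 hzero] with ω hω hzω
  have h1 : 0 ≤ truncNeg 1 ((X : Ω →ₘ[P] ℝ) ω) := by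
    simpa using (mul_eq_zero.1 hω).resolve_right hzω
  rcases le_max_iff.1 h1 with h2 | h2
  · exact h2.trans (min_le_left _ _)
  · norm_num at h2

end

end SurplusInvariance

/-! ### Assembly of the theorem, with `C` the zero set of the maximal weight -/

open SurplusInvariance in
theorem mainTheorem5 {Ω : Type*} [MeasurableSpace Ω] (P : Measure Ω) [IsProbabilityMeasure P]
    (𝒳 : Submodule ℝ (Ω →ₘ[P] ℝ)) [TopologicalSpace 𝒳]
    (h𝒳 : SurplusInvariance.IsAmbientSpace 𝒳)
    (𝒜 : Set 𝒳) (hacc : SurplusInvariance.IsAcceptanceSet 𝒜)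
    (hclosed : IsClosed 𝒜) (hconvex : Convex ℝ 𝒜)
    (hsurplus : SurplusInvariance.IsSurplusInvariant 𝒜) :
    ∃ C : Set Ω, MeasurableSet C ∧
      (∀ Z ∈ SurplusInvariance.barrierCone (SurplusInvariance.boundedPart 𝒜),
        ∀ᵐ ω ∂P, ω ∈ C → Z ω = 0) ∧
      (∃ Z ∈ SurplusInvariance.barrierCone (SurplusInvariance.boundedPart 𝒜),
        MemLp Z ∞ P ∧ ∀ᵐ ω ∂P, ω ∈ Cᶜ → 0 < Z ω) ∧
      SurplusInvariance.IsDirectSum 𝒜 (SurplusInvariance.band 𝒳 C)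
        (SurplusInvariance.restrict Cᶜ 𝒜) ∧
      SurplusInvariance.IsDirectSum (SurplusInvariance.recessionCone 𝒜)
        (SurplusInvariance.band 𝒳 C) (SurplusInvariance.bandPos 𝒳 Cᶜ) := by
  have h := h𝒳.isOrderContinuousLattice
  obtain ⟨w, hw, hmax⟩ := exists_maximal_barrierWeight 𝒜
  have hCm : MeasurableSet {ω | w ω = 0} := measurableSet_eq_fun hw.1 measurable_const
  have hB : ∀ Z ∈ barrierCone (boundedPart 𝒜), ∀ᵐ ω ∂P, ω ∈ {ω | w ω = 0} → Z ω = 0 := by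
    intro Z hZ
    filter_upwards [hmax _ (isBarrierWeight_of_mem_barrierCone h hacc.nonempty hsurplus hZ),
      barrierCone_nonneg h hacc.nonempty hsurplus hZ] with ω h1 h2 hω
    rcases min_eq_iff.1 (h1 hω) with h3 | h3
    · exact le_antisymm (ENNReal.ofReal_eq_zero.1 h3.1) h2
    · exact absurd h3.1 one_ne_zero
  have hmem : ∀ X ∈ 𝒜, ∀ Y : 𝒳, (∀ᵐ ω ∂P, ω ∉ {ω | w ω = 0} →
      (Y : Ω →ₘ[P] ℝ) ω = (X : Ω →ₘ[P] ℝ) ω) → Y ∈ 𝒜 := fun X hX Y hXY =>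
    (mem_hull_iff h hclosed hsurplus).1
      (hull_of_eq_on_compl h hclosed hconvex hsurplus hCm hB (mem_hull_of_mem h hsurplus hX) hXY)
  obtain ⟨X₀, hX₀⟩ := hacc.nonempty
  refine ⟨{ω | w ω = 0}, hCm, hB, ?_, ?_, ?_⟩
  · obtain ⟨Z, hZ, hZb, hZw⟩ := hw.exists_mem_barrierCone
    refine ⟨Z, hZ, hZb, ?_⟩
    filter_upwards [hZw] with ω hω hne
    rw [hω]
    exact ENNReal.toReal_pos hne ((hw.2.1 ω).trans_lt ENNReal.one_lt_top).ne
  · refine isDirectSum_band h.localization hCm (restrict_subset_band _ _) ?_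
      fun X hX V hV => ⟨X, hX, hV⟩
    rintro U hU V ⟨X, hX, hV⟩
    refine hmem X hX _ ?_
    filter_upwards [coeFn_add_ae U V, mem_band_iff.1 hU, hV] with ω h1 h2 h3 hω
    rw [h1, h2 hω, h3, Set.indicator_of_mem hω, zero_add]
  · refine isDirectSum_band h.localization hCm Set.inter_subset_left ?_ ?_
    · rintro U hU V ⟨-, hV⟩
      refine mem_recessionCone_iff.2 fun t ht => ?_
      -- A nonnegative position has no loss, so it is acceptable by comparison with any `X₀ ∈ 𝒜`; `t
      -- • (U + V)` differs from `t • V` only on `C`.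
      have hV0 : t • V ∈ 𝒜 := hsurplus.mem_of_ae_le hX₀ (by
        filter_upwards [coeFn_smul_ae t V, ae_le_of_le hV,
          AEEqFun.coeFn_zero (β := ℝ) (μ := P)] with ω h1 h2 h3
        rw [h3] at h2
        rw [h1]
        exact (min_le_right _ _).trans (mul_nonneg ht.le h2))
      refine hmem _ hV0 _ ?_
      filter_upwards [coeFn_smul_ae t (U + V), coeFn_smul_ae t V, coeFn_add_ae U V,
        mem_band_iff.1 hU] with ω h1 h2 h3 h4 hω
      rw [h1, h2, h3, h4 hω, zero_add]
    · intro X hX V hV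
      refine ⟨⟨X, Set.mem_univ _, hV⟩, AEEqFun.coeFn_le.1 ?_⟩
      filter_upwards [hV, hw.nonneg_of_mem_recessionCone h hsurplus hX,
        AEEqFun.coeFn_zero (β := ℝ) (μ := P)] with ω h1 h2 h3
      rw [h1, h3]
      exact Set.indicator_apply_nonneg fun hω => h2 hω
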